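/- Conventions. A tree is a set $T$ of functions with ordinal domains that is closed under restriction to smaller ordinals, ordered by extension $\subseteq$; we write $<_T$ for strict extension. $T_\alpha$ is the set of $x\in T$ with domain $\alpha$, $T_{<\alpha}=\bigcup_{\xi<\alpha}T_\xi$, and the height of $T$ is the least $\alpha$ with $T_\alpha=\emptyset$. A cofinal branch is a chain in $T$ that meets every level $T_\alpha$ below the height. For an ordinal $\gamma$, $T$ is $\gamma$-regressive if for every limit ordinal $\alpha$ below the height of $T$ with $\mathrm{cf}(\alpha)<\gamma$ there is a function $f_\alpha:T_\alpha\to T_{<\alpha}$ such that $f_\alpha(x)<_T x$ for all $x\in T_\alpha$ and, whenever $x,y\in T_\alpha$ are distinct, $f_\alpha(x)$ or $f_\alpha(y)$ is strictly above the meet of $x$ and $y$. For a regular uncountable cardinal $\lambda$, a weak $\lambda$-Kurepa-tree is a tree of height $\lambda$ all of whose levels have size at most $\lambda$ and which has at least $\lambda^+$ many cofinal branches. Lemma. Let $\lambda$ be a regular uncountable cardinal and $\kappa$ an ordinal (for instance a cardinal). Suppose that there is an elementary embedding $j:V\to M$ (for the language $\{\in\}$) of the universe $V$ of sets into a transitive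 class $M$ such that $\eta=\sup(j''\lambda)<j(\lambda)$ and $\mathrm{cf}^M(\eta)<j(\kappa)$, where $\mathrm{cf}^M(\eta)$ is the cofinality of $\eta$ computed in $M$. Then there is no $\kappa$-regressive weak $\lambda$-Kurepa-tree. -/

import Mathlib

universe u

open Set Cardinal
open scoped FirstOrder

namespace KurepaTree

/-! ### Elementary embeddings of the universe `V = ZFSet` into a transitive class -/

/-- The relation symbols of the language of set theory: one binary symbol. -/
inductive MemRel : ℕ → Type
  | mem : MemRel 2

/-- The first-order language of set theory. -/
def setLang : FirstOrder.Language.{0, 0} := ⟨fun _ => Empty, MemRel⟩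

/-- The universe of sets, with its membership relation. -/
instance universeStructure : setLang.Structure ZFSet.{u} where
  funMap f := nomatch f
  RelMap r := match r with
    | MemRel.mem => fun v => v 0 ∈ v 1

/-- A class of sets, with the true membership relation. -/
instance classStructure (M : Set ZFSet.{u}) : setLang.Structure M where
  funMap f := nomatch f
  RelMap r := match r with
    | MemRel.mem => fun v => (v 0 : ZFSet.{u}) ∈ (v 1 : ZFSet.{u})

/-- `M` is a transitive class. -/
def IsTransitiveClass (M : Set ZFSet.{u}) : Prop :=
  ∀ x ∈ M, ∀ y ∈ x, y ∈ M

/-- For `j : V → M` elementary with `M` transitive and `α` an ordinal, the set `j(α)` is a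
von Neumann ordinal; `jOrd j α` is this ordinal (an ordinal is its own rank). -/
noncomputable def jOrd {M : Set ZFSet.{u}} (j : ZFSet.{u} ↪ₑ[setLang] M) (α : Ordinal.{u}) :
    Ordinal.{u} :=
  (j α.toZFSet : ZFSet.{u}).rank

/-- The set `f` is a function from `δ` to `η` with range cofinal in `η`. -/
def IsCofinalMap (δ η : Ordinal.{u}) (f : ZFSet.{u}) : Prop :=
  ZFSet.IsFunc δ.toZFSet η.toZFSet f ∧
    ∀ β < η, ∃ ξ < δ, ∃ γ < η, β ≤ γ ∧ ZFSet.pair ξ.toZFSet γ.toZFSet ∈ f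

/-- `μ` is the cofinality of `η` as computed in the transitive class `M`: the least ordinal which
is the domain of a cofinal map into `η` that belongs to `M`. -/
def IsCofIn (M : Set ZFSet.{u}) (η μ : Ordinal.{u}) : Prop :=
  IsLeast {δ : Ordinal.{u} | ∃ f ∈ M, IsCofinalMap δ η f} μ

/-! ### Trees of functions -/

/-- The set `x` is a function whose domain is the ordinal `α`. -/
def IsSeq (α : Ordinal.{u}) (x : ZFSet.{u}) : Prop :=
  ∃ y : ZFSet.{u}, ZFSet.IsFunc α.toZFSet y x

/-- `T` is a tree of functions: a set of functions with ordinal domains, closed under restriction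
to smaller ordinals. The tree order is extension of functions, that is, inclusion. -/
structure IsTree (T : ZFSet.{u}) : Prop where
  isSeq : ∀ x ∈ T, ∃ α, IsSeq α x
  restrict_mem : ∀ x ∈ T, ∀ y ⊆ x, ∀ β, IsSeq β y → y ∈ T

/-- The level `T_α`. -/
noncomputable def level (T : ZFSet.{u}) (α : Ordinal.{u}) : ZFSet.{u} :=
  ZFSet.sep (fun x => IsSeq α x) T

/-- The subtree `T_{<α}`, the union of the levels below `α`. -/
noncomputable def below (T : ZFSet.{u}) (α : Ordinal.{u}) : ZFSet.{u} :=
  ZFSet.sep (fun x => ∃ ξ < α, IsSeq ξ x) T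

/-- The height of `T`: the least `α` such that the level `T_α` is empty. -/
noncomputable def height (T : ZFSet.{u}) : Ordinal.{u} :=
  sInf {α : Ordinal.{u} | level T α = ∅}

/-- The set of cofinal branches through `T`: the chains of `T` that meet every level of `T`. -/
noncomputable def cofinalBranches (T : ZFSet.{u}) : ZFSet.{u} :=
  ZFSet.sep (fun b => (∀ x ∈ b, ∀ y ∈ b, x ⊆ y ∨ y ⊆ x) ∧
    ∀ α < height T, ∃ x ∈ b, x ∈ level T α) T.powerset

/-- `f` maps `T_α` into `T_{<α}` and is regressive: `f(x) <_T x` for all `x ∈ T_α`, and if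
`x, y ∈ T_α` are distinct, then `f(x)` or `f(y)` is strictly above the meet of `x` and `y`, that
is, strictly above all their common predecessors. -/
def IsRegressiveOn (T : ZFSet.{u}) (α : Ordinal.{u}) (f : ZFSet.{u} → ZFSet.{u}) : Prop :=
  (∀ x ∈ level T α, f x ∈ below T α ∧ f x ⊂ x) ∧
    ∀ x ∈ level T α, ∀ y ∈ level T α, x ≠ y →
      (∀ z ∈ T, z ⊆ x → z ⊆ y → z ⊂ f x) ∨ (∀ z ∈ T, z ⊆ x → z ⊆ y → z ⊂ f y)

/-- `T` is `γ`-regressive: every level of limit height `α` below the height of `T` with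
`cf(α) < γ` carries a regressive function. -/
def IsRegressive (γ : Ordinal.{u}) (T : ZFSet.{u}) : Prop :=
  ∀ α < height T, Order.IsSuccLimit α → α.cof.ord < γ →
    ∃ f : ZFSet.{u} → ZFSet.{u}, IsRegressiveOn T α f

/-- `T` is a weak `lam`-Kurepa-tree: a tree of height `lam` whose levels have size at most `lam`,
with (at least) `lam⁺` many cofinal branches. -/
structure IsWeakKurepaTree (lam : Cardinal.{u}) (T : ZFSet.{u}) : Prop where
  isTree : IsTree T
  height_eq : height T = lam.ord
  card_level_le : ∀ α, (level T α).card ≤ lam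
  succ_le_card_branches : Order.succ lam ≤ (cofinalBranches T).card

end KurepaTree

/-! Suppose $T$ is such a tree. For a cofinal branch $b$, $j(b)$ is a branch through $j(T)$ and, as
$\eta<j(\lambda)$, has a node $x_b$ at level $\eta$, which extends $j(s)$ for all $s\in b$. By
elementarity some $f\in M$ is regressive on level $\eta$ of $j(T)$. Since $f(x_b)$ has length below
$\eta=\sup j''\lambda$, it lies below $j(t_b)$ for some $t_b\in b$. There are at most $\lambda$
nodes, so distinct branches $b,b'$ share $t=t_b=t_{b'}$ (`IsWeakKurepaTree.exists_ne_map_eq`). If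
$x_b=x_{b'}$, then $j$ identifies $b$ and $b'$ level by level, so $b=b'$. Otherwise $j(t)$ is below
both nodes, and regressivity puts $f(x_b)$ or $f(x_{b'})$ strictly above $j(t)$, a contradiction.

Elementarity is applied to explicit formulas: `Corr` builds them together with their meaning in $M$,
and `corr_regressive` and `abs_branch` are the main instances. -/

namespace KurepaTree

/-! ### Formulas evaluated in the universe and in a transitive class -/

section Corr

variable {M : Set ZFSet.{u}} {α : Type}

/-- A single formula with free variables in `α` defines `P` in the universe and `Q` in `M`. -/
def Corr (M : Set ZFSet.{u}) {α : Type} (P Q : (α → ZFSet.{u}) → Prop) : Prop :=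
  ∃ φ : setLang.Formula α, (∀ v : α → ZFSet.{u}, φ.Realize v ↔ P v) ∧
    ∀ w : α → M, φ.Realize w ↔ Q fun i => w i

/-- `P` is defined by a formula that is absolute between `M` and the universe. -/
def Abs (M : Set ZFSet.{u}) {α : Type} (P : (α → ZFSet.{u}) → Prop) : Prop :=
  Corr M P P

/-- The only place where elementarity of $j$ is invoked directly. -/
theorem Corr.transfer {P Q : (α → ZFSet.{u}) → Prop} (h : Corr M P Q)
    (j : ZFSet.{u} ↪ₑ[setLang] M) (v : α → ZFSet.{u}) : P v ↔ Q fun i => j (v i) := by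
  obtain ⟨φ, h₁, h₂⟩ := h
  rw [← h₁, ← j.map_formula φ v, h₂]
  rfl

theorem Corr.congr {P Q P' Q' : (α → ZFSet.{u}) → Prop} (h : Corr M P Q)
    (hP : ∀ v, P v ↔ P' v) (hQ : ∀ v, (∀ i, v i ∈ M) → (Q v ↔ Q' v)) : Corr M P' Q' := by
  obtain ⟨φ, h₁, h₂⟩ := h
  exact ⟨φ, fun v => (h₁ v).trans (hP v), fun w => (h₂ w).trans (hQ _ fun i => (w i).2)⟩

theorem Abs.congr {P P' : (α → ZFSet.{u}) → Prop} (h : Abs M P)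
    (hP : ∀ v, P v ↔ P' v) : Abs M P' :=
  Corr.congr h hP fun v _ => hP v

theorem Corr.imp {P Q P' Q' : (α → ZFSet.{u}) → Prop} (h : Corr M P Q) (h' : Corr M P' Q') :
    Corr M (fun v => P v → P' v) (fun v => Q v → Q' v) := by
  obtain ⟨φ, h₁, h₂⟩ := h
  obtain ⟨ψ, h₃, h₄⟩ := h'
  refine ⟨φ.imp ψ, fun v => ?_, fun v => ?_⟩
  · rw [FirstOrder.Language.Formula.realize_imp, h₁, h₃]
  · rw [FirstOrder.Language.Formula.realize_imp, h₂, h₄]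

theorem Corr.not {P Q : (α → ZFSet.{u}) → Prop} (h : Corr M P Q) :
    Corr M (fun v => ¬ P v) (fun v => ¬ Q v) := by
  obtain ⟨φ, h₁, h₂⟩ := h
  refine ⟨φ.not, fun v => ?_, fun v => ?_⟩
  · rw [FirstOrder.Language.Formula.realize_not, h₁]
  · rw [FirstOrder.Language.Formula.realize_not, h₂]

theorem Corr.and {P Q P' Q' : (α → ZFSet.{u}) → Prop} (h : Corr M P Q) (h' : Corr M P' Q') :
    Corr M (fun v => P v ∧ P' v) (fun v => Q v ∧ Q' v) :=
  (h.imp h'.not).not.congr (by simp) (by simp)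

theorem Corr.or {P Q P' Q' : (α → ZFSet.{u}) → Prop} (h : Corr M P Q) (h' : Corr M P' Q') :
    Corr M (fun v => P v ∨ P' v) (fun v => Q v ∨ Q' v) :=
  (h.not.imp h').congr (fun v => by tauto) (fun v _ => by tauto)

theorem Corr.all {P Q : (α → ZFSet.{u}) → ZFSet.{u} → Prop}
    (h : Corr M (α := α ⊕ Unit) (fun v => P (fun i => v (.inl i)) (v (.inr ())))
      (fun v => Q (fun i => v (.inl i)) (v (.inr ())))) :
    Corr M (fun v => ∀ a, P v a) (fun v => ∀ a ∈ M, Q v a) := by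
  obtain ⟨φ, h₁, h₂⟩ := h
  refine ⟨φ.iAlls Unit, fun v => ?_, fun v => ?_⟩
  · rw [FirstOrder.Language.Formula.realize_iAlls]
    exact ⟨fun h a => (h₁ _).1 (h fun _ => a), fun h i => (h₁ _).2 (h (i ()))⟩
  · rw [FirstOrder.Language.Formula.realize_iAlls]
    exact ⟨fun h a ha => (h₂ _).1 (h fun _ => ⟨a, ha⟩), fun h i => (h₂ _).2 (h _ (i ()).2)⟩

theorem Corr.ex {P Q : (α → ZFSet.{u}) → ZFSet.{u} → Prop}
    (h : Corr M (α := α ⊕ Unit) (fun v => P (fun i => v (.inl i)) (v (.inr ())))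
      (fun v => Q (fun i => v (.inl i)) (v (.inr ())))) :
    Corr M (fun v => ∃ a, P v a) (fun v => ∃ a ∈ M, Q v a) :=
  (Corr.all (P := fun v a => ¬ P v a) (Q := fun v a => ¬ Q v a) h.not).not.congr
    (by simp) (by simp)

theorem Abs.mem (i k : α) : Abs M (fun v => v i ∈ v k) := by
  let R : setLang.Relations 2 := MemRel.mem
  exact ⟨R.formula₂ (.var i) (.var k),
    fun v => (FirstOrder.Language.Formula.realize_rel₂ (R := R)).trans Iff.rfl,
    fun v => (FirstOrder.Language.Formula.realize_rel₂ (R := R)).trans Iff.rfl⟩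

theorem Abs.eq (i k : α) : Abs M (fun v => v i = v k) := by
  refine ⟨FirstOrder.Language.Term.equal (L := setLang) (.var i) (.var k),
    fun v => ?_, fun v => ?_⟩
  · rw [FirstOrder.Language.Formula.realize_equal]; rfl
  · rw [FirstOrder.Language.Formula.realize_equal]; exact Subtype.ext_iff

variable (hM : IsTransitiveClass M)
include hM

/-- Transitivity puts all elements of `v k` in $M$, so relativizing a bounded quantifier to $M$
changes nothing. -/
theorem Corr.ball {P Q : (α → ZFSet.{u}) → ZFSet.{u} → Prop} {k : α}
    (h : Corr M (α := α ⊕ Unit) (fun v => P (fun i => v (.inl i)) (v (.inr ())))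
      (fun v => Q (fun i => v (.inl i)) (v (.inr ())))) :
    Corr M (fun v => ∀ a ∈ v k, P v a) (fun v => ∀ a ∈ v k, Q v a) :=
  (Corr.all (P := fun v a => a ∈ v k → P v a) (Q := fun v a => a ∈ v k → Q v a)
    ((Abs.mem _ _).imp h)).congr (fun _ => Iff.rfl)
    fun _ hv => ⟨fun H a ha => H a (hM _ (hv k) _ ha) ha, fun H a _ => H a⟩

theorem Corr.bex {P Q : (α → ZFSet.{u}) → ZFSet.{u} → Prop} {k : α}
    (h : Corr M (α := α ⊕ Unit) (fun v => P (fun i => v (.inl i)) (v (.inr ())))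
      (fun v => Q (fun i => v (.inl i)) (v (.inr ())))) :
    Corr M (fun v => ∃ a ∈ v k, P v a) (fun v => ∃ a ∈ v k, Q v a) :=
  (Corr.ball hM (k := k) (P := fun v a => ¬ P v a) (Q := fun v a => ¬ Q v a) h.not).not.congr
    (by simp) (by simp)

theorem Abs.ball {P : (α → ZFSet.{u}) → ZFSet.{u} → Prop} {k : α}
    (h : Abs M (α := α ⊕ Unit) (fun v => P (fun i => v (.inl i)) (v (.inr ())))) :
    Abs M (fun v => ∀ a ∈ v k, P v a) :=
  Corr.ball hM h

theorem Abs.bex {P : (α → ZFSet.{u}) → ZFSet.{u} → Prop} {k : α}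
    (h : Abs M (α := α ⊕ Unit) (fun v => P (fun i => v (.inl i)) (v (.inr ())))) :
    Abs M (fun v => ∃ a ∈ v k, P v a) :=
  Corr.bex hM h

theorem Abs.subset (i k : α) : Abs M (fun v => v i ⊆ v k) :=
  Abs.congr (Abs.ball hM (P := fun v a => a ∈ v k) (k := i) (Abs.mem _ _)) fun _ => Iff.rfl

theorem Abs.eq_doubleton (i k l : α) : Abs M (fun v => v i = {v k, v l}) := by
  refine Abs.congr ((Abs.mem k i).and ((Abs.mem l i).and
    (Abs.ball hM (k := i) (P := fun v a => a = v k ∨ a = v l)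
      ((Abs.eq _ _).or (Abs.eq _ _))))) fun v => ?_
  constructor
  · rintro ⟨h₁, h₂, h₃⟩
    ext a
    rw [ZFSet.mem_pair]
    exact ⟨h₃ a, by rintro (rfl | rfl) <;> assumption⟩
  · intro h
    simp [h]

theorem Abs.eq_pair (i k l : α) : Abs M (fun v => v i = ZFSet.pair (v k) (v l)) := by
  refine Abs.congr
    -- The singleton in the Kuratowski pair is written as a doubleton so that `Abs.eq_doubleton`
    -- covers both components.
    ((Abs.bex hM (k := i) (P := fun v a => a = {v k, v k}) (Abs.eq_doubleton hM _ _ _)).and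
    ((Abs.bex hM (k := i) (P := fun v a => a = {v k, v l}) (Abs.eq_doubleton hM _ _ _)).and
    (Abs.ball hM (k := i) (P := fun v a => a = {v k, v k} ∨ a = {v k, v l})
      ((Abs.eq_doubleton hM _ _ _).or (Abs.eq_doubleton hM _ _ _))))) fun v => ?_
  simp only [ZFSet.pair_eq_singleton, exists_eq_right, ZFSet.pair]
  constructor
  · rintro ⟨h₁, h₂, h₃⟩
    ext a
    rw [ZFSet.mem_pair]
    exact ⟨h₃ a, by rintro (rfl | rfl) <;> assumption⟩
  · intro h
    simp [h]

theorem Abs.pair_mem (i k l : α) : Abs M (fun v => ZFSet.pair (v i) (v k) ∈ v l) :=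
  Abs.congr (Abs.bex hM (k := l) (P := fun v a => a = ZFSet.pair (v i) (v k))
    (Abs.eq_pair hM _ _ _)) fun v => by simp

/-- `x` is a function with domain `a`. -/
def IsFuncOn (a x : ZFSet.{u}) : Prop :=
  ∃ y : ZFSet.{u}, ZFSet.IsFunc a y x

omit hM in
-- Removes the unbounded quantifier over the codomain, for absoluteness: values are reached through
-- the elements of the Kuratowski pairs, and conversely $\bigcup\bigcup x$ serves as codomain.
theorem isFuncOn_iff {a x : ZFSet.{u}} : IsFuncOn a x ↔
    (∀ p ∈ x, ∃ ξ ∈ a, ∃ d ∈ p, ∃ w ∈ d, p = ZFSet.pair ξ w) ∧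
    ∀ ξ ∈ a, ∃ p ∈ x, ∃ d ∈ p, ∃ w ∈ d, p = ZFSet.pair ξ w ∧
      ∀ q ∈ x, ∀ e ∈ q, ∀ z ∈ e, q = ZFSet.pair ξ z → z = w := by
  have key (p ξ w : ZFSet.{u}) (h : p = ZFSet.pair ξ w) : ∃ d ∈ p, w ∈ d :=
    ⟨{ξ, w}, by simp [h, ZFSet.pair], by simp⟩
  constructor
  · rintro ⟨y, h₁, h₂⟩
    refine ⟨fun p hp => ?_, fun ξ hξ => ?_⟩
    · obtain ⟨ξ, hξ, w, -, h⟩ := ZFSet.mem_prod.1 (h₁ hp)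
      obtain ⟨d, hd, hw⟩ := key _ _ _ h
      exact ⟨ξ, hξ, d, hd, w, hw, h⟩
    · obtain ⟨w, hw, hw'⟩ := h₂ ξ hξ
      obtain ⟨d, hd, hwd⟩ := key _ _ _ rfl
      exact ⟨_, hw, d, hd, w, hwd, rfl, fun q hq e _ z _ h => hw' z (by simpa only [h] using hq)⟩
  · rintro ⟨h₁, h₂⟩
    refine ⟨ZFSet.sUnion (ZFSet.sUnion x), fun p hp => ?_, fun ξ hξ => ?_⟩
    · obtain ⟨ξ, hξ, d, hd, w, hw, h⟩ := h₁ p hp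
      exact ZFSet.mem_prod.2 ⟨ξ, hξ, w, ZFSet.mem_sUnion.2 ⟨d, ZFSet.mem_sUnion.2 ⟨p, hp, hd⟩, hw⟩, h⟩
    · obtain ⟨p, hp, d, hd, w, hw, h, H⟩ := h₂ ξ hξ
      refine ⟨w, by simpa [← h] using hp, fun z hz => ?_⟩
      obtain ⟨e, he, hze⟩ := key _ _ _ rfl
      exact H _ hz e he z hze rfl

theorem Abs.isFuncOn (i k : α) : Abs M (fun v => IsFuncOn (v i) (v k)) := by
  refine Abs.congr (Corr.and ?_ ?_) fun v => isFuncOn_iff.symm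
  · refine Abs.ball hM (Abs.bex hM (Abs.bex hM (Abs.bex hM ?_)))
    exact Abs.eq_pair hM _ _ _
  · refine Abs.ball hM (Abs.bex hM (Abs.bex hM (Abs.bex hM (Corr.and ?_ ?_))))
    · exact Abs.eq_pair hM _ _ _
    · exact Abs.ball hM (Abs.ball hM (Abs.ball hM
        ((Abs.eq_pair hM _ _ _).imp (Abs.eq _ _))))

theorem Abs.isOrdinal (i : α) : Abs M (fun v => (v i).IsOrdinal) := by
  refine Abs.congr (Corr.and (P := fun v => ∀ a ∈ v i, a ⊆ v i)
    (P' := fun v => ∀ a ∈ v i, ∀ b ∈ a, b ⊆ a) ?_ ?_) fun v =>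
    ZFSet.isOrdinal_iff_forall_mem_isTransitive.symm
  · exact Abs.ball hM (Abs.subset hM _ _)
  · exact Abs.ball hM (Abs.ball hM (Abs.subset hM _ _))

end Corr

/-! ### Regressive functions and cofinal maps as sets -/

/-- The set `f` relates every element of level `a` of `T` to some node below it, in such a way
that nodes related to distinct elements satisfy the regressivity condition. -/
def IsRegressiveRel (T a f : ZFSet.{u}) : Prop :=
  (∀ x ∈ T, IsFuncOn a x → ∃ y ∈ T, ZFSet.pair x y ∈ f ∧ y ⊆ x ∧ ∃ ξ ∈ a, IsFuncOn ξ y) ∧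
    ∀ x ∈ T, ∀ x' ∈ T, IsFuncOn a x → IsFuncOn a x' → x ≠ x' →
      ∀ y ∈ T, ∀ y' ∈ T, ZFSet.pair x y ∈ f → ZFSet.pair x' y' ∈ f →
        (∀ z ∈ T, z ⊆ x → z ⊆ x' → z ⊆ y ∧ z ≠ y) ∨ ∀ z ∈ T, z ⊆ x → z ⊆ x' → z ⊆ y' ∧ z ≠ y'

/-- The set `c` contains a partial function from `d` to `a` with range cofinal in `a`. -/
def IsPartialCofinalMap (d a c : ZFSet.{u}) : Prop :=
  (∀ ξ ∈ d, ∀ γ ∈ a, ∀ γ' ∈ a, ZFSet.pair ξ γ ∈ c → ZFSet.pair ξ γ' ∈ c → γ = γ') ∧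
    ∀ β ∈ a, ∃ ξ ∈ d, ∃ γ ∈ a, (β ∈ γ ∨ β = γ) ∧ ZFSet.pair ξ γ ∈ c

section Absoluteness

variable {M : Set ZFSet.{u}} {α : Type} (hM : IsTransitiveClass M)
include hM

theorem Abs.isRegressiveRel (i k l : α) :
    Abs M (fun v => IsRegressiveRel (v i) (v k) (v l)) := by
  refine Corr.and ?_ ?_
  · refine Abs.ball hM (Corr.imp (Abs.isFuncOn hM _ _) (Abs.bex hM (Corr.and
      (Abs.pair_mem hM _ _ _) (Corr.and (Abs.subset hM _ _) (Abs.bex hM ?_)))))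
    exact Abs.isFuncOn hM _ _
  · refine Abs.ball hM (Abs.ball hM (Corr.imp (Abs.isFuncOn hM _ _) (Corr.imp
      (Abs.isFuncOn hM _ _) (Corr.imp (Abs.eq _ _).not (Abs.ball hM (Abs.ball hM (Corr.imp
        (Abs.pair_mem hM _ _ _) (Corr.imp (Abs.pair_mem hM _ _ _) (Corr.or ?_ ?_)))))))))
    · exact Abs.ball hM (Corr.imp (Abs.subset hM _ _) (Corr.imp (Abs.subset hM _ _)
        (Corr.and (Abs.subset hM _ _) (Abs.eq _ _).not)))
    · exact Abs.ball hM (Corr.imp (Abs.subset hM _ _) (Corr.imp (Abs.subset hM _ _)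
        (Corr.and (Abs.subset hM _ _) (Abs.eq _ _).not)))

theorem Abs.isPartialCofinalMap (i k l : α) :
    Abs M (fun v => IsPartialCofinalMap (v i) (v k) (v l)) := by
  refine Corr.and ?_ ?_
  · exact Abs.ball hM (Abs.ball hM (Abs.ball hM (Corr.imp (Abs.pair_mem hM _ _ _)
      (Corr.imp (Abs.pair_mem hM _ _ _) (Abs.eq _ _)))))
  · exact Abs.ball hM (Abs.bex hM (Abs.bex hM (Corr.and (Corr.or (Abs.mem _ _) (Abs.eq _ _))
      (Abs.pair_mem hM _ _ _))))

/-- Regressivity of the tree `v 0` at the levels in `v 2` admitting a cofinal map with domain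
in `v 1`. -/
theorem corr_regressive : Corr M (α := Fin 3)
    (fun v => ∀ a ∈ v 2, (∃ b ∈ a, b ∈ a) → (∀ b ∈ a, ∃ c ∈ a, b ∈ c) → ∀ d ∈ v 1,
      ∀ c, IsPartialCofinalMap d a c → ∃ f, IsRegressiveRel (v 0) a f)
    (fun v => ∀ a ∈ v 2, (∃ b ∈ a, b ∈ a) → (∀ b ∈ a, ∃ c ∈ a, b ∈ c) → ∀ d ∈ v 1,
      ∀ c ∈ M, IsPartialCofinalMap d a c → ∃ f ∈ M, IsRegressiveRel (v 0) a f) := by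
  -- Only the quantifiers over `c` and `f` are unbounded, so only these are relativized to $M$.
  -- Small cofinality is expressed by a witness `c`, so cofinality itself needs no formula.
  refine Corr.ball hM (Corr.imp (Abs.bex hM (Abs.mem _ _))
    (Corr.imp (Abs.ball hM (Abs.bex hM (Abs.mem _ _))) (Corr.ball hM (Corr.all (Corr.imp
      (Abs.isPartialCofinalMap hM _ _ _) (Corr.ex ?_))))))
  exact Abs.isRegressiveRel hM _ _ _

/-- `v 0` is a chain in the tree `v 1` that meets all levels in `v 2`. -/
theorem abs_branch : Abs M (α := Fin 3)
    (fun v => (∀ x ∈ v 0, x ∈ v 1) ∧ (∀ x ∈ v 0, ∀ y ∈ v 0, x ⊆ y ∨ y ⊆ x) ∧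
      ∀ a ∈ v 2, ∃ x ∈ v 0, IsFuncOn a x) := by
  refine Corr.and ?_ (Corr.and ?_ ?_)
  · exact Abs.ball hM (Abs.mem _ _)
  · exact Abs.ball hM (Abs.ball hM (Corr.or (Abs.subset hM _ _) (Abs.subset hM _ _)))
  · exact Abs.ball hM (Abs.bex hM (Abs.isFuncOn hM _ _))

end Absoluteness

/-! ### Functions with ordinal domains -/

theorem IsSeq.exists_pair_mem {α β : Ordinal.{u}} {x : ZFSet.{u}} (hx : IsSeq α x) (h : β < α) :
    ∃ w, ZFSet.pair β.toZFSet w ∈ x := by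
  obtain ⟨y, -, hx⟩ := hx
  exact (hx _ (Ordinal.toZFSet_mem_toZFSet_iff.2 h)).exists

theorem IsSeq.pair_unique {α : Ordinal.{u}} {x ξ w w' : ZFSet.{u}} (hx : IsSeq α x)
    (h : ZFSet.pair ξ w ∈ x) (h' : ZFSet.pair ξ w' ∈ x) : w = w' := by
  obtain ⟨y, hxy, hx⟩ := hx
  exact (hx ξ (ZFSet.pair_mem_prod.1 (hxy h)).1).unique h h'

theorem IsSeq.exists_eq_pair {α : Ordinal.{u}} {x p : ZFSet.{u}} (hx : IsSeq α x)
    (h : p ∈ x) : ∃ β < α, ∃ w, p = ZFSet.pair β.toZFSet w := by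
  obtain ⟨y, hxy, -⟩ := hx
  obtain ⟨ξ, hξ, w, -, rfl⟩ := ZFSet.mem_prod.1 (hxy h)
  obtain ⟨β, hβ, rfl⟩ := Ordinal.mem_toZFSet_iff.1 hξ
  exact ⟨β, hβ, w, rfl⟩

theorem IsSeq.le_of_subset {α β : Ordinal.{u}} {x y : ZFSet.{u}} (hx : IsSeq α x)
    (hy : IsSeq β y) (h : x ⊆ y) : α ≤ β := by
  by_contra! hlt
  obtain ⟨w, hw⟩ := hx.exists_pair_mem hlt
  obtain ⟨γ, hγ, w', hw'⟩ := hy.exists_eq_pair (h hw)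
  exact hγ.ne' (Ordinal.toZFSet_injective (ZFSet.pair_inj.1 hw').1)

theorem IsSeq.subset_of_le {α β γ : Ordinal.{u}} {x y z : ZFSet.{u}} (hx : IsSeq α x)
    (hy : IsSeq β y) (hz : IsSeq γ z) (hxz : x ⊆ z) (hyz : y ⊆ z) (h : α ≤ β) : x ⊆ y := by
  intro p hp
  obtain ⟨ξ, hξ, w, rfl⟩ := hx.exists_eq_pair hp
  obtain ⟨w', hw'⟩ := hy.exists_pair_mem (hξ.trans_le h)
  rwa [hz.pair_unique (hxz hp) (hyz hw')]

theorem IsSeq.eq_of_subset {α : Ordinal.{u}} {x y : ZFSet.{u}} (hx : IsSeq α x)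
    (hy : IsSeq α y) (h : x ⊆ y) : x = y := by
  refine h.antisymm ?_
  exact hy.subset_of_le hx hy subset_rfl h le_rfl

theorem IsSeq.exists_restrict {α β : Ordinal.{u}} {x : ZFSet.{u}} (hx : IsSeq α x)
    (h : β ≤ α) : ∃ y ⊆ x, IsSeq β y := by
  obtain ⟨r, hxr, hx'⟩ := id hx
  refine ⟨ZFSet.sep (fun p => ∃ ξ ∈ β.toZFSet, ∃ w, p = ZFSet.pair ξ w) x, ZFSet.sep_subset,
    r, fun p hp => ?_, fun ξ hξ => ?_⟩
  · obtain ⟨hp, ξ, hξ, w, rfl⟩ := ZFSet.mem_sep.1 hp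
    exact ZFSet.pair_mem_prod.2 ⟨hξ, (ZFSet.pair_mem_prod.1 (hxr hp)).2⟩
  · obtain ⟨w, hw, hw'⟩ := hx' ξ (Ordinal.toZFSet_subset_toZFSet_iff.2 h hξ)
    exact ⟨w, ZFSet.mem_sep.2 ⟨hw, ξ, hξ, w, rfl⟩, fun z hz => hw' z (ZFSet.mem_sep.1 hz).1⟩

/-! ### Trees and their branches -/

theorem IsWeakKurepaTree.exists_isSeq {lam : Cardinal.{u}} {T x : ZFSet.{u}} (hlam : ℵ₀ ≤ lam)
    (hT : IsWeakKurepaTree lam T) (hx : x ∈ T) : ∃ α < lam.ord, IsSeq α x := by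
  obtain ⟨α, hα⟩ := hT.isTree.isSeq x hx
  refine ⟨α, ?_, hα⟩
  -- If no level were empty, the infimum would take the default value 0, which is not `lam.ord`;
  -- hence the height is attained.
  have hne : {α : Ordinal.{u} | level T α = ∅}.Nonempty := by
    by_contra hne
    have h := hT.height_eq
    rw [height, not_nonempty_iff_eq_empty.1 hne, Ordinal.sInf_empty] at h
    exact (Cardinal.isSuccLimit_ord hlam).ne_bot h.symm
  have hempty : level T (height T) = ∅ := csInf_mem hne
  by_contra! hle
  rw [← hT.height_eq] at hle
  obtain ⟨y, hyx, hy⟩ := hα.exists_restrict hle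
  exact ZFSet.notMem_empty y
    (hempty ▸ ZFSet.mem_sep.2 ⟨hT.isTree.restrict_mem x hx y hyx _ hy, hy⟩)

theorem IsWeakKurepaTree.card_le {lam : Cardinal.{u}} {T : ZFSet.{u}} (hlam : ℵ₀ ≤ lam)
    (hT : IsWeakKurepaTree lam T) : T.card ≤ lam := by
  rw [← Cardinal.lift_le.{u + 1}, ← ZFSet.cardinalMk_coe_sort]
  have hsub : (T : Set ZFSet.{u}) ⊆ ⋃ α ∈ Iio lam.ord, (level T α : Set ZFSet.{u}) := by
    intro x hx
    obtain ⟨α, hα, hx'⟩ := hT.exists_isSeq hlam hx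
    exact mem_iUnion₂.2 ⟨α, hα, ZFSet.mem_sep.2 ⟨hx, hx'⟩⟩
  have hcard : #(Iio lam.ord) = Cardinal.lift.{u + 1} lam := by
    rw [Cardinal.mk_Iio_ordinal, Cardinal.card_ord]
  refine (Cardinal.mk_le_mk_of_subset hsub).trans ((Cardinal.mk_biUnion_le _ _).trans ?_)
  rw [hcard]
  refine (mul_le_mul_right (ciSup_le' fun α => ?_) _).trans
    (Cardinal.mul_eq_self (Cardinal.aleph0_le_lift.2 hlam)).le
  exact (ZFSet.cardinalMk_coe_sort (x := level T α)).trans_le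
    (Cardinal.lift_le.2 (hT.card_level_le α))

theorem IsWeakKurepaTree.exists_ne_map_eq {lam : Cardinal.{u}} {T : ZFSet.{u}} (hlam : ℵ₀ ≤ lam)
    (hT : IsWeakKurepaTree lam T) (g : ZFSet.{u} → ZFSet.{u})
    (hg : ∀ b ∈ cofinalBranches T, g b ∈ T) :
    ∃ b ∈ cofinalBranches T, ∃ b' ∈ cofinalBranches T, b ≠ b' ∧ g b = g b' := by
  by_contra! hne
  have hinj : Function.Injective
      (fun b : (cofinalBranches T : Set ZFSet.{u}) => (⟨g b, hg b b.2⟩ : (T : Set ZFSet.{u}))) := by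
    intro b b' h
    by_contra hbb
    exact hne b b.2 b' b'.2 (fun h => hbb (Subtype.ext h)) (congrArg Subtype.val h)
  have h := Cardinal.mk_le_of_injective hinj
  change #(cofinalBranches T) ≤ #T at h
  rw [ZFSet.cardinalMk_coe_sort, ZFSet.cardinalMk_coe_sort, Cardinal.lift_le] at h
  exact (Order.lt_succ lam).not_ge
    ((hT.succ_le_card_branches.trans h).trans (hT.card_le hlam))

/-- A cofinal branch is determined by its nodes level by level. -/
theorem cofinalBranch_subset {T b b' : ZFSet.{u}} {θ : Ordinal.{u}}
    (hT : ∀ x ∈ T, ∃ α < θ, IsSeq α x) (hb : b ⊆ T) (hb' : ∀ α < θ, ∃ x ∈ b', IsSeq α x)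
    (h : ∀ α, ∀ x ∈ b, ∀ y ∈ b', IsSeq α x → IsSeq α y → x = y) : b ⊆ b' := by
  intro x hx
  obtain ⟨α, hα, hxα⟩ := hT x (hb hx)
  obtain ⟨y, hy, hyα⟩ := hb' α hα
  rwa [h α x hx y hy hxα hyα]

/-! ### Cofinality and regressivity in the universe -/

/-- The range is cofinal in `α`, and single-valuedness makes a choice of preimages an injection into
`δ`. -/
theorem IsPartialCofinalMap.ord_cof_le {δ α : Ordinal.{u}} {c : ZFSet.{u}}
    (h : IsPartialCofinalMap δ.toZFSet α.toZFSet c) : α.cof.ord ≤ δ := by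
  obtain ⟨h₁, h₂⟩ := h
  let s : Set (Iio α) := {γ | ∃ ξ < δ, ZFSet.pair ξ.toZFSet γ.1.toZFSet ∈ c}
  have hs : IsCofinal s := by
    intro β
    obtain ⟨_, hξ, _, hγ, hle, hp⟩ := h₂ _ (Ordinal.toZFSet_mem_toZFSet_iff.2 β.2)
    obtain ⟨ξ, hξ', rfl⟩ := Ordinal.mem_toZFSet_iff.1 hξ
    obtain ⟨γ, hγ', rfl⟩ := Ordinal.mem_toZFSet_iff.1 hγ
    refine ⟨⟨γ, hγ'⟩, ⟨ξ, hξ', hp⟩, ?_⟩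
    change β.1 ≤ γ
    rcases hle with hle | hle
    · exact (Ordinal.toZFSet_mem_toZFSet_iff.1 hle).le
    · exact (Ordinal.toZFSet_injective hle).le
  choose g hg hgc using fun γ : s => γ.2
  have hinj : Function.Injective (fun γ : s => (⟨g γ, hg γ⟩ : Iio δ)) := by
    intro γ γ' hγγ
    have hγγ' : g γ = g γ' := congrArg Subtype.val hγγ
    have := h₁ _ (Ordinal.toZFSet_mem_toZFSet_iff.2 (hg γ)) _
      (Ordinal.toZFSet_mem_toZFSet_iff.2 γ.1.2) _ (Ordinal.toZFSet_mem_toZFSet_iff.2 γ'.1.2)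
      (hgc γ) (by rw [hγγ']; exact hgc γ')
    exact Subtype.ext (Subtype.ext (Ordinal.toZFSet_injective this))
  have hle := (Order.cof_le hs).trans (Cardinal.mk_le_of_injective hinj)
  rw [Ordinal.cof_Iio, ← Ordinal.lift_cof, Cardinal.mk_Iio_ordinal, Cardinal.lift_le] at hle
  exact Cardinal.ord_le.2 hle

/-- Separation turns the graph of `f` on `T` into a set, over which a first-order formula can
quantify. -/
theorem IsRegressiveOn.exists_isRegressiveRel {T : ZFSet.{u}} {α : Ordinal.{u}}
    {f : ZFSet.{u} → ZFSet.{u}} (hf : IsRegressiveOn T α f) :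
    ∃ r, IsRegressiveRel T α.toZFSet r := by
  obtain ⟨h₁, h₂⟩ := hf
  have mem_iff {x y : ZFSet.{u}} (hx : x ∈ T) (hy : y ∈ T) :
      ZFSet.pair x y ∈ ZFSet.sep (fun p => ∃ x, p = ZFSet.pair x (f x)) (ZFSet.prod T T) ↔
        y = f x := by
    rw [ZFSet.mem_sep, ZFSet.pair_mem_prod]
    constructor
    · rintro ⟨-, z, hz⟩
      obtain ⟨rfl, rfl⟩ := ZFSet.pair_inj.1 hz
      rfl
    · rintro rfl
      exact ⟨⟨hx, hy⟩, x, rfl⟩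
  refine ⟨ZFSet.sep (fun p => ∃ x, p = ZFSet.pair x (f x)) (ZFSet.prod T T),
    fun x hx hxα => ?_, fun x hx x' hx' hxα hxα' hne y hy y' hy' hxy hxy' => ?_⟩
  · obtain ⟨hfb, hfx⟩ := h₁ x (ZFSet.mem_sep.2 ⟨hx, hxα⟩)
    obtain ⟨hfT, ξ, hξ, hfξ⟩ := ZFSet.mem_sep.1 hfb
    exact ⟨f x, hfT, (mem_iff hx hfT).2 rfl, hfx.1, _, Ordinal.toZFSet_mem_toZFSet_iff.2 hξ, hfξ⟩
  · rw [mem_iff hx hy] at hxy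
    rw [mem_iff hx' hy'] at hxy'
    subst hxy hxy'
    exact (h₂ x (ZFSet.mem_sep.2 ⟨hx, hxα⟩) x' (ZFSet.mem_sep.2 ⟨hx', hxα'⟩) hne).imp
      (fun H z hz hzx hzx' => ⟨(H z hz hzx hzx').1, (H z hz hzx hzx').ne⟩)
      (fun H z hz hzx hzx' => ⟨(H z hz hzx hzx').1, (H z hz hzx hzx').ne⟩)

theorem IsRegressive.exists_isRegressiveRel {T : ZFSet.{u}} {κ : Ordinal.{u}}
    (h : IsRegressive κ T) : ∀ a ∈ (height T).toZFSet, (∃ b ∈ a, b ∈ a) →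
      (∀ b ∈ a, ∃ c ∈ a, b ∈ c) → ∀ d ∈ κ.toZFSet, ∀ c, IsPartialCofinalMap d a c →
        ∃ f, IsRegressiveRel T a f := by
  intro a ha hne hlim d hd c hc
  obtain ⟨α, hα, rfl⟩ := Ordinal.mem_toZFSet_iff.1 ha
  obtain ⟨δ, hδ, rfl⟩ := Ordinal.mem_toZFSet_iff.1 hd
  have hα' : Order.IsSuccLimit α := by
    refine ⟨?_, Order.isSuccPrelimit_of_succ_lt fun β hβ => ?_⟩
    · obtain ⟨b, hb, -⟩ := hne
      obtain ⟨β, hβ, -⟩ := Ordinal.mem_toZFSet_iff.1 hb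
      exact fun hmin => (hmin.eq_bot ▸ hβ).not_ge bot_le
    · obtain ⟨c, hc, hβc⟩ := hlim _ (Ordinal.toZFSet_mem_toZFSet_iff.2 hβ)
      obtain ⟨γ, hγ, rfl⟩ := Ordinal.mem_toZFSet_iff.1 hc
      exact (Order.succ_le_of_lt (Ordinal.toZFSet_mem_toZFSet_iff.1 hβc)).trans_lt hγ
  obtain ⟨f, hf⟩ := h α hα hα' (hc.ord_cof_le.trans_lt hδ)
  exact hf.exists_isRegressiveRel

/-! ### The images of ordinals and sequences under an elementary embedding -/

section Embedding

variable {M : Set ZFSet.{u}} (hM : IsTransitiveClass M) (j : ZFSet.{u} ↪ₑ[setLang] M)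

theorem mem_iff_map_mem (x y : ZFSet.{u}) :
    x ∈ y ↔ (j x : ZFSet.{u}) ∈ (j y : ZFSet.{u}) :=
  (Abs.mem (0 : Fin 2) 1).transfer j ![x, y]

include hM

theorem subset_iff_map_subset (x y : ZFSet.{u}) :
    x ⊆ y ↔ (j x : ZFSet.{u}) ⊆ (j y : ZFSet.{u}) :=
  (Abs.subset hM (0 : Fin 2) 1).transfer j ![x, y]

/-- Being an ordinal is absolute, and an ordinal is its own rank. -/
theorem map_toZFSet (α : Ordinal.{u}) : (j α.toZFSet : ZFSet.{u}) = (jOrd j α).toZFSet :=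
  (ZFSet.IsOrdinal.toZFSet_rank_eq (((Abs.isOrdinal hM (0 : Fin 1)).transfer j
    ![α.toZFSet]).1 (ZFSet.isOrdinal_toZFSet α))).symm

theorem jOrd_lt_jOrd {α β : Ordinal.{u}} (h : α < β) : jOrd j α < jOrd j β := by
  rwa [← Ordinal.toZFSet_mem_toZFSet_iff, ← map_toZFSet hM, ← map_toZFSet hM,
    ← mem_iff_map_mem, Ordinal.toZFSet_mem_toZFSet_iff]

theorem IsSeq.map {α : Ordinal.{u}} {x : ZFSet.{u}} (h : IsSeq α x) :
    IsSeq (jOrd j α) (j x) := by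
  have : IsFuncOn (j α.toZFSet : ZFSet.{u}) (j x) :=
    ((Abs.isFuncOn hM (0 : Fin 2) 1).transfer j ![α.toZFSet, x]).1 h
  rwa [map_toZFSet hM] at this

end Embedding

theorem IsCofinalMap.isPartialCofinalMap {δ η : Ordinal.{u}} {c : ZFSet.{u}}
    (h : IsCofinalMap δ η c) : IsPartialCofinalMap δ.toZFSet η.toZFSet c := by
  refine ⟨fun ξ hξ γ _ γ' _ hγ hγ' => (h.1.2 ξ hξ).unique hγ hγ', fun b hb => ?_⟩
  obtain ⟨β, hβ, rfl⟩ := Ordinal.mem_toZFSet_iff.1 hb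
  obtain ⟨ξ, hξ, γ, hγ, hle, hp⟩ := h.2 β hβ
  refine ⟨_, Ordinal.toZFSet_mem_toZFSet_iff.2 hξ, _, Ordinal.toZFSet_mem_toZFSet_iff.2 hγ,
    ?_, hp⟩
  rw [Ordinal.toZFSet_mem_toZFSet_iff, Ordinal.toZFSet_injective.eq_iff]
  exact hle.lt_or_eq

end KurepaTree

open KurepaTree in
theorem lemma6 (lam : Cardinal.{u}) (hreg : lam.IsRegular) (hunc : ℵ₀ < lam)
    (kap : Ordinal.{u})
    (hemb : ∃ (M : Set ZFSet.{u}) (j : ZFSet.{u} ↪ₑ[KurepaTree.setLang] M) (η : Ordinal.{u}),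
      KurepaTree.IsTransitiveClass M ∧
      IsLUB (KurepaTree.jOrd j '' Set.Iio lam.ord) η ∧
      η < KurepaTree.jOrd j lam.ord ∧
      ∃ μ, KurepaTree.IsCofIn M η μ ∧ μ < KurepaTree.jOrd j kap) :
    ¬ ∃ T : ZFSet.{u}, KurepaTree.IsWeakKurepaTree lam T ∧ KurepaTree.IsRegressive kap T := by
  rintro ⟨T, hT, hTreg⟩
  obtain ⟨M, j, η, hM, hη, hηlt, μ, ⟨⟨c, hcM, hc⟩, -⟩, hμ⟩ := hemb
  have hlim := Cardinal.isSuccLimit_ord hreg.aleph0_le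
  -- Strict because $j(\alpha)<j(\alpha+1)\le\eta$, `lam.ord` being a limit.
  have hjη {α : Ordinal.{u}} (hα : α < lam.ord) : jOrd j α < η :=
    (jOrd_lt_jOrd hM j (Order.lt_succ α)).trans_le
      (hη.1 (mem_image_of_mem _ (hlim.succ_lt hα)))
  have hηj {β : Ordinal.{u}} (hβ : β < η) : ∃ α < lam.ord, β < jOrd j α := by
    obtain ⟨_, ⟨α, hα, rfl⟩, hlt⟩ := (lt_isLUB_iff hη).1 hβ
    exact ⟨α, hα, hlt⟩
  -- a regressive relation at level `η` of `j T`
  have hregM := ((corr_regressive hM).transfer j ![T, kap.toZFSet, lam.ord.toZFSet]).1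
    (hT.height_eq ▸ hTreg.exists_isRegressiveRel)
  change ∀ a ∈ (j lam.ord.toZFSet : ZFSet.{u}), (∃ b ∈ a, b ∈ a) → (∀ b ∈ a, ∃ c ∈ a, b ∈ c) →
    ∀ d ∈ (j kap.toZFSet : ZFSet.{u}), ∀ c ∈ M, IsPartialCofinalMap d a c →
      ∃ f ∈ M, IsRegressiveRel (j T) a f at hregM
  rw [map_toZFSet hM, map_toZFSet hM] at hregM
  -- $\eta$ is a nonzero limit, as $j''\lambda$ is cofinal in it. The map `c` in $M$ with domain `μ`
  -- below $j(\kappa)$ witnesses small cofinality; leastness of `μ` plays no role.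
  obtain ⟨f, -, hf₁, hf₂⟩ := hregM η.toZFSet (Ordinal.toZFSet_mem_toZFSet_iff.2 hηlt)
    (by
      have h := Ordinal.toZFSet_mem_toZFSet_iff.2 (hjη hlim.bot_lt)
      exact ⟨_, h, h⟩)
    (fun b hb => by
      obtain ⟨β, hβ, rfl⟩ := Ordinal.mem_toZFSet_iff.1 hb
      obtain ⟨α, hα, hlt⟩ := hηj hβ
      exact ⟨_, Ordinal.toZFSet_mem_toZFSet_iff.2 (hjη hα),
        Ordinal.toZFSet_mem_toZFSet_iff.2 hlt⟩)
    μ.toZFSet (Ordinal.toZFSet_mem_toZFSet_iff.2 hμ) c hcM hc.isPartialCofinalMap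
  have hB {b : ZFSet.{u}} (hb : b ∈ cofinalBranches T) : b ⊆ T ∧
      (∀ x ∈ b, ∀ y ∈ b, x ⊆ y ∨ y ⊆ x) ∧ ∀ α < lam.ord, ∃ x ∈ b, IsSeq α x := by
    obtain ⟨hbT, hch, hlev⟩ := ZFSet.mem_sep.1 hb
    refine ⟨ZFSet.mem_powerset.1 hbT, hch, fun α hα => ?_⟩
    obtain ⟨x, hx, hxα⟩ := hlev α (hT.height_eq ▸ hα)
    exact ⟨x, hx, (ZFSet.mem_sep.1 hxα).2⟩
  -- every branch `b` extends to a node of `j T` at level `η`, whose regressive value is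
  -- below the image of some node of `b`
  have key : ∀ b ∈ cofinalBranches T, ∃ t ∈ b, ∃ x ∈ (j T : ZFSet.{u}), IsSeq η x ∧
      (∀ s ∈ b, (j s : ZFSet.{u}) ⊆ x) ∧
      ∃ y ∈ (j T : ZFSet.{u}), ZFSet.pair x y ∈ f ∧ y ⊆ j t := by
    intro b hb
    obtain ⟨hbT, hch, hlev⟩ := hB hb
    have hjb := ((abs_branch hM).transfer j ![b, T, lam.ord.toZFSet]).1
      ⟨fun x hx => hbT hx, hch, fun a ha => by
        obtain ⟨α, hα, rfl⟩ := Ordinal.mem_toZFSet_iff.1 ha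
        exact hlev α hα⟩
    change (∀ x ∈ (j b : ZFSet.{u}), x ∈ (j T : ZFSet.{u})) ∧
      (∀ x ∈ (j b : ZFSet.{u}), ∀ y ∈ (j b : ZFSet.{u}), x ⊆ y ∨ y ⊆ x) ∧
      ∀ a ∈ (j lam.ord.toZFSet : ZFSet.{u}), ∃ x ∈ (j b : ZFSet.{u}), IsFuncOn a x at hjb
    obtain ⟨hjbT, hjch, hjlev⟩ := hjb
    rw [map_toZFSet hM] at hjlev
    obtain ⟨x, hxb, hx⟩ := hjlev _ (Ordinal.toZFSet_mem_toZFSet_iff.2 hηlt)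
    change IsSeq η x at hx
    have hsub : ∀ s ∈ b, (j s : ZFSet.{u}) ⊆ x := by
      intro s hs
      obtain ⟨α, hα, hsα⟩ := hT.exists_isSeq hreg.aleph0_le (hbT hs)
      -- Both nodes lie on $j(b)$; the other inclusion would give $\eta\le j(\alpha)$.
      refine (hjch _ ((mem_iff_map_mem j s b).1 hs) x hxb).resolve_right fun h => ?_
      exact (hx.le_of_subset (hsα.map hM j) h).not_gt (hjη hα)
    obtain ⟨y, hyT, hxy, hyx, ξ, hξ, hy⟩ := hf₁ x (hjbT x hxb) hx
    obtain ⟨ξ, hξη, rfl⟩ := Ordinal.mem_toZFSet_iff.1 hξ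
    -- Take `t` on `b` at a level `α` with $\xi<j(\alpha)$: then `y` and $j(t)$ are both initial
    -- segments of `x`, and `y` is the shorter.
    obtain ⟨α, hα, hlt⟩ := hηj hξη
    obtain ⟨t, ht, htα⟩ := hlev α hα
    exact ⟨t, ht, x, hjbT x hxb, hx, hsub, y, hyT, hxy,
      IsSeq.subset_of_le hy (htα.map hM j) hx hyx (hsub t ht) hlt.le⟩
  choose! t ht x hxT hx hsub y hyT hxy hyt using key
  obtain ⟨b, hb, b', hb', hne, htt⟩ := hT.exists_ne_map_eq hreg.aleph0_le t
    fun b hb => (hB hb).1 (ht b hb)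
  by_cases hxx : x b = x b'
  -- Nodes `s`, `s'` of equal length have images that are initial segments of the same node and of
  -- equal length, so the images agree.
  · have heq : ∀ α, ∀ s ∈ b, ∀ s' ∈ b', IsSeq α s → IsSeq α s' → s = s' := by
      intro α s hs s' hs' hsα hsα'
      refine hsα.eq_of_subset hsα' ((subset_iff_map_subset hM j s s').2 ?_)
      exact (hsα.map hM j).subset_of_le (hsα'.map hM j) (hx b hb) (hsub b hb s hs)
        (hxx ▸ hsub b' hb' s' hs') le_rfl
    have hlt := fun x (hx : x ∈ T) => hT.exists_isSeq hreg.aleph0_le hx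
    exact hne ((cofinalBranch_subset hlt (hB hb).1 (hB hb').2.2 heq).antisymm
      (cofinalBranch_subset hlt (hB hb').1 (hB hb).2.2
        fun α s hs s' hs' hsα hsα' => (heq α s' hs' s hs hsα' hsα).symm))
  -- The image of the shared node is a common predecessor of `x b` and `x b'`, so it is the `z` to
  -- use in `hf₂`.
  · have hjt := (mem_iff_map_mem j _ _).1 ((hB hb).1 (ht b hb))
    have hjt' : (j (t b) : ZFSet.{u}) ⊆ x b' := htt ▸ hsub b' hb' _ (ht b' hb')
    rcases hf₂ _ (hxT b hb) _ (hxT b' hb') (hx b hb) (hx b' hb') hxx _ (hyT b hb) _ (hyT b' hb')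
      (hxy b hb) (hxy b' hb') with h | h
    · obtain ⟨hle, hne⟩ := h _ hjt (hsub b hb _ (ht b hb)) hjt'
      exact hne (hle.antisymm (hyt b hb))
    · obtain ⟨hle, hne⟩ := h _ hjt (hsub b hb _ (ht b hb)) hjt'
      exact hne (hle.antisymm (htt ▸ hyt b' hb'))
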